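/- For an integer $m \ge 2$, choose an ordered pair $(p,q)$ uniformly at random from all ordered pairs of distinct primes of binary length $m$ (that is, primes with $2^{m-1} \le p \ne q \le 2^m-1$), put $N = pq$, and then choose $g$ uniformly at random from $\mathbb{Z}_N^*$. Let $\omega_N(g)$ denote the order of $g$ in the multiplicative group $\mathbb{Z}_N^*$, let $\phi$ be Euler's totient function, and let $\log$ be the natural logarithm. Then for every real $k \ge 2$ there is a constant $C_k > 0$, depending only on $k$, such that for all integers $m \ge 2$, \[ \Pr\left( \omega_N(g) < \frac{\phi(N)}{m^k} \right) \le \frac{C_k}{m^{(k-2)/5} (\log m)^{2/5}}, \] where the probability is over the random choice of $(p,q)$ and $g$. -/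

import Mathlib

/-- The primes of binary length `m`: the primes `p` with `2 ^ (m - 1) ≤ p ≤ 2 ^ m - 1`. -/
def primesOfLength (m : ℕ) : Finset ℕ :=
  (Finset.Icc (2 ^ (m - 1)) (2 ^ m - 1)).filter Nat.Prime

/-- The ordered pairs `(p, q)` of distinct primes of binary length `m`. -/
def distinctPrimePairs (m : ℕ) : Finset (ℕ × ℕ) :=
  (primesOfLength m).offDiag

/-- The probability, for `g` uniform in the unit group of `ℤ / N ℤ`, that the period
(the multiplicative order) of `g` is less than `t`. -/
noncomputable def probPeriodLT (N : ℕ) (t : ℝ) : ℝ :=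
  (Nat.card {g : (ZMod N)ˣ // (orderOf g : ℝ) < t} : ℝ) / (Nat.card (ZMod N)ˣ : ℝ)

/-- The probability that the period of `g` is less than `φ(N) / A`, where first `(p, q)` is
uniform among the ordered pairs of distinct primes of binary length `m`, `N = p * q`, and then
`g` is uniform in the unit group of `ℤ / N ℤ`. -/
noncomputable def probSmallPeriod (m : ℕ) (A : ℝ) : ℝ :=
  (∑ pq ∈ distinctPrimePairs m,
      probPeriodLT (pq.1 * pq.2) ((Nat.totient (pq.1 * pq.2) : ℝ) / A)) /
    ((distinctPrimePairs m).card : ℝ)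

/-!
The proof gives the stronger bound `O(m ^ (-k / 5))`, with no logarithm; the stated bound follows
from `log m ≤ m`.

Write `g` as a pair `(a, b)` in `(ZMod p)ˣ × (ZMod q)ˣ`, and let `i` and `j` be the indices of the
cyclic subgroups generated by `a` and `b`. The order of `g` is the least common multiple of the
orders of `a` and `b`, so `φ(N) / ord g ≤ i * j * gcd (p - 1) (q - 1)`. If this exceeds `A`, then
`A ^ (1 / 5) ≤ i ^ (3 / 5) + j ^ (3 / 5) + gcd (p - 1) (q - 1) ^ (3 / 5)`. Averaging over `g`, and
bounding the last term by a sum over all its divisors, bounds the conditional probability by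
`A ^ (-1 / 5)` times divisor sums of `p - 1`, `q - 1` and their greatest common divisor
(`probPeriodLT_mul_le`).

It remains to see that these divisor sums are bounded on average over the primes of length `m`,
for which it suffices that a proportion at most `O(d ^ (-9 / 10))` of these primes is `1` modulo
`d`, uniformly in `d` (`exists_card_primes_dvd_sub_one_le`). No sieve is needed for this. The
product of the first `n` terms `d + 1, 2 * d + 1, …` of the progression, times `d ^ n`, is
divisible by `n !`, and the quotient, which is at most `(d * (d + 1)) ^ n`, is still divisible by
all the primes greater than `n` in the progression. Hence there are at most `O(2 ^ m / m * log d / d)`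
primes of length `m` in the progression, whereas the total number of primes of length `m` is at
least a constant times `2 ^ m / m`, by the factorization of the central binomial coefficient as in
the proof of Bertrand's postulate.
-/

/-! ### Primes congruent to one modulo `d`: upper bound -/

/-- Division by `n !` of a product of `n` consecutive terms of an arithmetic progression costs only
the factor `d ^ n`: at a prime power coprime to `d`, multiplication by an inverse of `d` turns the
terms into consecutive integers, and at a prime dividing `d` the factor `d ^ n` suffices. -/
theorem factorial_dvd_pow_mul_prod_progression (d n : ℕ) :
    n.factorial ∣ d ^ n * ∏ j ∈ Finset.range n, (d * (j + 1) + 1) := by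
  rw [Nat.dvd_iff_prime_pow_dvd_dvd]
  intro l k hl hk
  by_cases hld : l ∣ d
  · have hkn : k ≤ n :=
      ((hl.pow_dvd_iff_le_factorization n.factorial_ne_zero).1 hk).trans
        ((Nat.factorization_factorial_le_div_pred hl n).trans (Nat.div_le_self _ _))
    exact ((pow_dvd_pow l hkn).trans (pow_dvd_pow_of_dvd hld n)).mul_right _
  · have hcop : Nat.Coprime d (l ^ k) :=
      (Nat.Coprime.pow_left k ((Nat.Prime.coprime_iff_not_dvd hl).2 hld)).symm
    obtain ⟨e, he⟩ : ∃ e, d * e ≡ 1 [MOD l ^ k] := by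
      obtain ⟨e, he⟩ := Nat.exists_mul_mod_eq_of_coprime 1 hcop (pow_pos hl.pos k).ne'
      exact ⟨e, he.2⟩
    have hecop : Nat.Coprime (l ^ k) e := by
      have := he.gcd_eq
      rw [Nat.gcd_one_left] at this
      exact (Nat.Coprime.coprime_mul_left this).symm
    have hmod : (∏ j ∈ Finset.range n, e * (d * (j + 1) + 1)) ≡
        ∏ j ∈ Finset.range n, (e + 1 + j) [MOD l ^ k] := by
      refine Nat.ModEq.prod fun j _ => ?_
      have h1 := (he.mul_right (j + 1)).add_right e
      calc e * (d * (j + 1) + 1) = d * e * (j + 1) + e := by ring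
        _ ≡ 1 * (j + 1) + e [MOD l ^ k] := h1
        _ = e + 1 + j := by ring
    have hasc : l ^ k ∣ ∏ j ∈ Finset.range n, (e + 1 + j) := by
      rw [← Nat.ascFactorial_eq_prod_range]
      exact hk.trans (Nat.factorial_dvd_ascFactorial _ _)
    have h2 := (hmod.dvd_iff dvd_rfl).2 hasc
    rw [Finset.prod_mul_distrib, Finset.prod_const, Finset.card_range] at h2
    exact ((Nat.Coprime.pow_right n hecop).dvd_of_dvd_mul_left h2).mul_left _

theorem mem_primesOfLength {m p : ℕ} :
    p ∈ primesOfLength m ↔ (2 ^ (m - 1) ≤ p ∧ p ≤ 2 ^ m - 1) ∧ p.Prime := by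
  simp [primesOfLength]

/-- A Chebyshev-type bound in the progression `1` modulo `d`: the product of the primes counted here
is coprime to `n !`, where `n = (2 ^ m - 1) / d`, and so divides
`d ^ n * ∏ j < n, (d * (j + 1) + 1) / n !`. -/
theorem two_pow_pow_card_le {m d : ℕ} (hm : 2 ≤ m) (hd : 2 ≤ d) :
    (2 ^ (m - 1)) ^ ((primesOfLength m).filter (fun p => d ∣ p - 1)).card ≤
      (d * (d + 1)) ^ ((2 ^ m - 1) / d) := by
  set n := (2 ^ m - 1) / d with hn
  set T := (primesOfLength m).filter (fun p => d ∣ p - 1) with hT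
  have hpow : 2 ^ m = 2 * 2 ^ (m - 1) := by
    rw [← pow_succ']; congr 1; omega
  have hpos : 0 < 2 ^ (m - 1) := by positivity
  have hTm : ∀ p ∈ T, (2 ^ (m - 1) ≤ p ∧ p ≤ 2 ^ m - 1) ∧ p.Prime ∧ d ∣ p - 1 := by
    intro p hp
    obtain ⟨h1, h2⟩ := Finset.mem_filter.1 hp
    obtain ⟨h3, h4⟩ := mem_primesOfLength.1 h1
    exact ⟨h3, h4, h2⟩
  -- Here `2 ≤ d` matters: it puts all primes of length `m` above `n`.
  have hnlt : n < 2 ^ (m - 1) := by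
    rw [hn, Nat.div_lt_iff_lt_mul (by omega)]
    nlinarith [Nat.sub_lt (show 0 < 2 ^ m by positivity) one_pos]
  have hdvd : ∏ p ∈ T, p ∣ ∏ j ∈ Finset.range n, (d * (j + 1) + 1) := by
    refine Finset.prod_primes_dvd _ (fun p hp => (hTm p hp).2.1.prime) fun p hp => ?_
    obtain ⟨⟨h1, h2⟩, h3, c, hc⟩ := hTm p hp
    have hp2 := h3.two_le
    have hc0 : c ≠ 0 := by rintro rfl; omega
    have hcn : c ≤ n := by
      rw [hn, Nat.le_div_iff_mul_le (by omega), mul_comm]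
      omega
    have hpe : p = d * (c - 1 + 1) + 1 := by
      rw [Nat.sub_add_cancel (by omega)]; omega
    conv_lhs => rw [hpe]
    exact Finset.dvd_prod_of_mem (fun j => d * (j + 1) + 1)
      (Finset.mem_range.2 (by omega : c - 1 < n))
  have hcop : Nat.Coprime (∏ p ∈ T, p) n.factorial := by
    refine Nat.Coprime.prod_left fun p hp => ?_
    obtain ⟨⟨h1, h2⟩, h3, -⟩ := hTm p hp
    rw [Nat.Prime.coprime_iff_not_dvd h3, h3.dvd_factorial]
    omega
  have hmul : (∏ p ∈ T, p) * n.factorial ∣ d ^ n * ∏ j ∈ Finset.range n, (d * (j + 1) + 1) :=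
    hcop.mul_dvd_of_dvd_of_dvd (hdvd.mul_left _) (factorial_dvd_pow_mul_prod_progression d n)
  have hle := Nat.le_of_dvd (Nat.mul_pos (pow_pos (by omega) n)
    (Finset.prod_pos fun j _ => Nat.succ_pos _)) hmul
  have hQ : ∏ j ∈ Finset.range n, (d * (j + 1) + 1) ≤ (d + 1) ^ n * n.factorial := by
    rw [← Finset.prod_range_add_one_eq_factorial, ← Finset.card_range n, ← Finset.prod_const,
      Finset.card_range, ← Finset.prod_mul_distrib]
    exact Finset.prod_le_prod' fun j _ => by nlinarith
  have hfin : (∏ p ∈ T, p) * n.factorial ≤ (d * (d + 1)) ^ n * n.factorial := by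
    calc _ ≤ _ := hle
      _ ≤ d ^ n * ((d + 1) ^ n * n.factorial) := Nat.mul_le_mul_left _ hQ
      _ = _ := by rw [mul_pow, mul_assoc]
  calc (2 ^ (m - 1)) ^ T.card = ∏ p ∈ T, 2 ^ (m - 1) := by rw [Finset.prod_const]
    _ ≤ ∏ p ∈ T, p := Finset.prod_le_prod' fun p hp => (hTm p hp).1.1
    _ ≤ _ := Nat.le_of_mul_le_mul_right hfin n.factorial_pos

theorem card_primes_dvd_sub_one_le {m d : ℕ} (hm : 2 ≤ m) (hd : 2 ≤ d) :
    (((primesOfLength m).filter (fun p => d ∣ p - 1)).card : ℝ) ≤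
      120 * (2 ^ m / m) * (d : ℝ) ^ (-(9 / 10) : ℝ) := by
  set K := ((primesOfLength m).filter (fun p => d ∣ p - 1)).card
  have hd0 : (0 : ℝ) < d := by exact_mod_cast (by omega : 0 < d)
  have hd2 : (2 : ℝ) ≤ d := by exact_mod_cast hd
  have hm2 : (2 : ℝ) ≤ m := by exact_mod_cast hm
  have h : ((2 : ℝ) ^ (m - 1)) ^ K ≤ ((d : ℝ) * (d + 1)) ^ ((2 ^ m - 1) / d) := by
    exact_mod_cast two_pow_pow_card_le hm hd
  have hlog := Real.log_le_log (by positivity) h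
  rw [Real.log_pow, Real.log_pow, Real.log_pow, Nat.cast_sub (by omega), Nat.cast_one] at hlog
  have hn : (((2 ^ m - 1) / d : ℕ) : ℝ) ≤ 2 ^ m / d := by
    refine Nat.cast_div_le.trans ?_
    gcongr
    exact_mod_cast Nat.sub_le _ _
  have hld : Real.log ((d : ℝ) * (d + 1)) ≤ 30 * (d : ℝ) ^ (1 / 10 : ℝ) := by
    have h3 : (d : ℝ) * (d + 1) ≤ d ^ 3 := by nlinarith [mul_pos hd0 hd0]
    have h4 := Real.log_le_log (by positivity) h3
    rw [Real.log_pow] at h4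
    have h5 := Real.log_le_rpow_div hd0.le (show (0 : ℝ) < 1 / 10 by norm_num)
    push_cast at h4
    linarith
  have hl2 : (1 / 2 : ℝ) ≤ Real.log 2 := by linarith [Real.log_two_gt_d9]
  have hmain : (K : ℝ) * (m / 4) ≤ 2 ^ m / d * (30 * (d : ℝ) ^ (1 / 10 : ℝ)) := by
    calc (K : ℝ) * (m / 4) ≤ K * ((m - 1) * Real.log 2) := by
          gcongr
          nlinarith
      _ ≤ _ := hlog
      _ ≤ _ := by
          gcongr
          exact Real.log_nonneg (by nlinarith)
  have hpow : (d : ℝ) ^ (-(9 / 10) : ℝ) = (d : ℝ) ^ (1 / 10 : ℝ) / d := by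
    rw [show (-(9 / 10) : ℝ) = 1 / 10 - 1 by norm_num, Real.rpow_sub_one hd0.ne']
  rw [hpow]
  have : (K : ℝ) = K * (m / 4) * (4 / m) := by field_simp
  rw [this]
  calc (K : ℝ) * (m / 4) * (4 / m) ≤ 2 ^ m / d * (30 * (d : ℝ) ^ (1 / 10 : ℝ)) * (4 / m) := by
        gcongr
    _ = _ := by ring

/-! ### A lower bound for the number of primes of length `m` -/

/-- The estimate behind Bertrand's postulate, with the primes in `(n, 2 * n]` counted instead of
assumed absent. Primes up to `√(2 * n)` contribute at most `2 * n` each, larger primes up to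
`2 * n / 3` occur to the first power at most, and those between `2 * n / 3` and `n` not at all. -/
theorem centralBinom_le_mul_pow_card_primes {n : ℕ} (hn : 2 < n) :
    n.centralBinom ≤ (2 * n) ^ (Nat.sqrt (2 * n)) * 4 ^ (2 * n / 3) *
      (2 * n) ^ ((Finset.Ioc n (2 * n)).filter Nat.Prime).card := by
  have h2n : 1 ≤ 2 * n := by omega
  have hf : ∀ p, p ^ n.centralBinom.factorization p ≤ 2 * n :=
    fun p => Nat.pow_factorization_choose_le (by omega)
  let R := Finset.range (2 * n + 1)
  have hpt : ∀ p ∈ R, p ^ n.centralBinom.factorization p ≤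
      (if p ∈ Finset.Icc 1 (Nat.sqrt (2 * n)) then 2 * n else 1) *
      (if p ≤ 2 * n / 3 ∧ p.Prime then p else 1) *
      (if n < p ∧ p.Prime then 2 * n else 1) := by
    intro p hp
    by_cases hpp : p.Prime
    swap
    · rw [Nat.factorization_eq_zero_of_not_prime _ hpp, pow_zero]
      simp only [hpp, and_false, if_false, mul_one]
      split_ifs <;> omega
    have hp1 := hpp.one_lt
    by_cases h1 : p ≤ Nat.sqrt (2 * n)
    · rw [if_pos (Finset.mem_Icc.2 ⟨hp1.le, h1⟩)]
      calc _ ≤ 2 * n * 1 * 1 := by simpa using hf p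
        _ ≤ _ := by
          gcongr <;> split_ifs <;> omega
    · rw [if_neg (by simp [h1])]
      by_cases h2 : p ≤ 2 * n / 3
      · rw [if_pos ⟨h2, hpp⟩, if_neg (by omega)]
        have h3 : n.centralBinom.factorization p ≤ 1 :=
          Nat.factorization_choose_le_one (Nat.sqrt_lt'.mp (not_le.1 h1))
        simpa using Nat.pow_le_pow_right hp1.le h3
      · rw [if_neg (by omega)]
        by_cases h3 : n < p
        · rw [if_pos ⟨h3, hpp⟩]
          simpa using hf p
        · rw [Nat.factorization_centralBinom_of_two_mul_self_lt_three_mul hn (by omega) (by omega)]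
          simp [h3]
  rw [← Nat.prod_pow_factorization_centralBinom n]
  refine (Finset.prod_le_prod' hpt).trans ?_
  rw [Finset.prod_mul_distrib, Finset.prod_mul_distrib]
  refine Nat.mul_le_mul (Nat.mul_le_mul ?_ ?_) ?_
  · rw [← Finset.prod_filter, Finset.prod_const]
    refine Nat.pow_le_pow_right h2n ?_
    calc _ ≤ (Finset.Icc 1 (Nat.sqrt (2 * n))).card :=
          Finset.card_le_card fun x hx => (Finset.mem_filter.1 hx).2
      _ = _ := by simp
  · rw [← Finset.prod_filter]
    refine le_trans (le_of_eq ?_) (primorial_le_four_pow (2 * n / 3))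
    refine Finset.prod_congr ?_ fun _ _ => rfl
    ext x
    simp only [R, Finset.mem_filter, Finset.mem_range]
    constructor
    · rintro ⟨-, h1, h2⟩
      exact ⟨by omega, h2⟩
    · rintro ⟨h1, h2⟩
      exact ⟨by omega, by omega, h2⟩
  · rw [← Finset.prod_filter, Finset.prod_const]
    refine Nat.pow_le_pow_right h2n (Finset.card_le_card fun x hx => ?_)
    simp only [R, Finset.mem_filter, Finset.mem_range, Finset.mem_Ioc] at hx ⊢
    obtain ⟨h0, h1, h2⟩ := hx
    exact ⟨by omega, h2⟩

theorem card_primes_Ioc_le_card_primesOfLength {m : ℕ} (hm : 2 ≤ m) :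
    ((Finset.Ioc (2 ^ (m - 1)) (2 * 2 ^ (m - 1))).filter Nat.Prime).card ≤
      (primesOfLength m).card := by
  refine Finset.card_le_card fun p hp => ?_
  have hpow : 2 * 2 ^ (m - 1) = 2 ^ m := by
    rw [← pow_succ']; congr 1; omega
  simp only [Finset.mem_filter, Finset.mem_Ioc, hpow] at hp
  refine mem_primesOfLength.2 ⟨⟨hp.1.1.le, ?_⟩, hp.2⟩
  have : p ≠ 2 ^ m := fun h => Nat.Prime.not_prime_pow hm (h ▸ hp.2)
  omega

theorem primesOfLength_card_pos {m : ℕ} (hm : 2 ≤ m) : 0 < (primesOfLength m).card := by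
  refine lt_of_lt_of_le ?_ (card_primes_Ioc_le_card_primesOfLength hm)
  obtain ⟨p, hp, h1, h2⟩ := Nat.exists_prime_lt_and_le_two_mul (2 ^ (m - 1)) (by positivity)
  exact Finset.card_pos.2 ⟨p, Finset.mem_filter.2 ⟨Finset.mem_Ioc.2 ⟨h1, h2⟩, hp⟩⟩

theorem two_pow_div_three_le {m : ℕ} (hm : 3 ≤ m) :
    (2 : ℝ) ^ m / 3 ≤ ((primesOfLength m).card + √2 ^ m + 1) * m := by
  set n := 2 ^ (m - 1) with hn
  set M := (primesOfLength m).card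
  have hpow : 2 * n = 2 ^ m := by
    rw [hn, ← pow_succ']; congr 1; omega
  have hn4 : 4 ≤ n := by
    calc 4 = 2 ^ 2 := rfl
      _ ≤ n := Nat.pow_le_pow_right (by norm_num) (by omega)
  have h1 := Nat.four_pow_lt_mul_centralBinom n hn4
  have h2 := centralBinom_le_mul_pow_card_primes (n := n) (by omega)
  have h3 : 4 ^ n ≤ (2 * n) ^ (Nat.sqrt (2 * n) + M + 1) * 4 ^ (2 * n / 3) := by
    calc 4 ^ n ≤ (2 * n) * n.centralBinom := h1.le.trans (Nat.mul_le_mul_right _ (by omega))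
      _ ≤ (2 * n) * ((2 * n) ^ (Nat.sqrt (2 * n)) * 4 ^ (2 * n / 3) * (2 * n) ^ M) := by
          refine Nat.mul_le_mul_left _ (h2.trans (Nat.mul_le_mul_left _ ?_))
          exact Nat.pow_le_pow_right (by omega) (card_primes_Ioc_le_card_primesOfLength (by omega))
      _ = _ := by ring
  rw [hpow] at h3
  have h4 : 2 ^ (2 * n) ≤ 2 ^ (m * (Nat.sqrt (2 ^ m) + M + 1) + 2 * (2 ^ m / 3)) := by
    calc 2 ^ (2 * n) = 4 ^ n := by rw [pow_mul]; norm_num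
      _ ≤ _ := h3
      _ = _ := by rw [← pow_mul, show (4 : ℕ) = 2 ^ 2 by rfl, ← pow_mul, ← pow_add]
  rw [Nat.pow_le_pow_iff_right (by norm_num), hpow] at h4
  have h5 : ((Nat.sqrt (2 ^ m) : ℕ) : ℝ) ≤ √2 ^ m := by
    refine Real.nat_sqrt_le_real_sqrt.trans (le_of_eq ?_)
    rw [Real.sqrt_eq_iff_mul_self_eq (by positivity) (by positivity), ← mul_pow,
      Real.mul_self_sqrt (by norm_num)]
    norm_num
  have h6 : (((2 ^ m / 3 : ℕ)) : ℝ) ≤ 2 ^ m / 3 := by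
    simpa using (Nat.cast_div_le (α := ℝ) (m := 2 ^ m) (n := 3))
  have h7 : (2 : ℝ) ^ m ≤ m * ((Nat.sqrt (2 ^ m) : ℕ) + M + 1) + 2 * ((2 ^ m / 3 : ℕ) : ℝ) := by
    exact_mod_cast h4
  have h8 : (m : ℝ) * ((Nat.sqrt (2 ^ m) : ℕ) + M + 1) ≤ m * (√2 ^ m + M + 1) := by gcongr
  linarith

theorem exists_mul_two_pow_div_le_card_primesOfLength :
    ∃ c : ℝ, 0 < c ∧ ∀ m : ℕ, 2 ≤ m → c * (2 ^ m / m) ≤ (primesOfLength m).card := by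
  have hs : √2 < 2 := by
    rw [Real.sqrt_lt' (by norm_num)]; norm_num
  have hs1 : (1 : ℝ) ≤ √2 := Real.one_le_sqrt.2 (by norm_num)
  have hlim := tendsto_self_mul_const_pow_of_lt_one (r := √2 / 2) (by positivity) (by linarith)
  obtain ⟨m₀, hm₀⟩ := Filter.eventually_atTop.1
    ((hlim.eventually (gt_mem_nhds (show (0 : ℝ) < 1 / 12 by norm_num))).and
      (Filter.eventually_ge_atTop 3))
  refine ⟨min (1 / 6) (1 / 2 ^ m₀), by positivity, fun m hm => ?_⟩
  have hm0 : (0 : ℝ) < m := by exact_mod_cast (by omega : 0 < m)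
  rcases le_or_gt m₀ m with h | h
  -- For large `m`, the terms of lower order in `two_pow_div_three_le` absorb at most half of
  -- `2 ^ m / 3`; the remaining finitely many `m` need only one prime each.
  · obtain ⟨h1, h2⟩ := hm₀ m h
    have h3 := two_pow_div_three_le h2
    have h4 : (m : ℝ) * √2 ^ m ≤ 2 ^ m / 12 := by
      rw [div_pow, mul_div_assoc', div_lt_iff₀ (by positivity)] at h1
      linarith
    have h5 : (1 : ℝ) ≤ √2 ^ m := one_le_pow₀ hs1
    have h6 : (m : ℝ) * 1 ≤ m * √2 ^ m := by gcongr
    have h7 : (2 : ℝ) ^ m / 6 ≤ (primesOfLength m).card * m := by nlinarith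
    calc _ ≤ (1 / 6 : ℝ) * (2 ^ m / m) := by gcongr; exact min_le_left _ _
      _ = 2 ^ m / 6 / m := by ring
      _ ≤ _ := (div_le_iff₀ hm0).2 h7
  · have h1 : (1 : ℝ) ≤ (primesOfLength m).card := by exact_mod_cast primesOfLength_card_pos hm
    refine le_trans ?_ h1
    calc _ ≤ (1 / 2 ^ m₀ : ℝ) * (2 ^ m₀ / 1) := by
          gcongr
          · exact min_le_right _ _
          · norm_num
          · exact_mod_cast (by omega : 1 ≤ m)
      _ = 1 := by field_simp

/-- Among the primes of length `m`, the proportion of those with `d ∣ p - 1` is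
`O(d ^ (-9 / 10))`, uniformly in `m` and `d`. -/
theorem exists_card_primes_dvd_sub_one_le :
    ∃ C : ℝ, 0 < C ∧ ∀ m d : ℕ, 2 ≤ m → 1 ≤ d →
      (((primesOfLength m).filter (fun p => d ∣ p - 1)).card : ℝ) ≤
        C * (primesOfLength m).card * (d : ℝ) ^ (-(9 / 10) : ℝ) := by
  obtain ⟨c, hc, h⟩ := exists_mul_two_pow_div_le_card_primesOfLength
  refine ⟨max 1 (120 / c), by positivity, fun m d hm hd => ?_⟩
  rcases hd.eq_or_lt with rfl | hd
  · simp only [Nat.cast_one, Real.one_rpow, mul_one]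
    calc _ ≤ 1 * ((primesOfLength m).card : ℝ) := by
          rw [one_mul]; exact_mod_cast Finset.card_filter_le _ _
      _ ≤ _ := by gcongr; exact le_max_left _ _
  · refine (card_primes_dvd_sub_one_le hm hd).trans ?_
    refine mul_le_mul_of_nonneg_right ?_ (by positivity)
    calc (120 : ℝ) * (2 ^ m / m) = 120 / c * (c * (2 ^ m / m)) := by field_simp
      _ ≤ max 1 (120 / c) * (primesOfLength m).card := by
        gcongr
        · exact le_max_right _ _
        · exact h m hm

/-! ### Elements of small order in a product of two cyclic groups -/

/-- Moments of the index of the subgroup generated by an element of a cyclic group: exactly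
`φ(n / d) ≤ n / d` elements generate a subgroup of index `d`. -/
theorem sum_index_rpow_le {G : Type*} [Group G] [Fintype G] [IsCyclic G] (s : ℝ) :
    ∑ a : G, ((Fintype.card G : ℝ) / orderOf a) ^ s ≤
      Fintype.card G * ∑ d ∈ (Fintype.card G).divisors, (d : ℝ) ^ (s - 1) := by
  classical
  set n := Fintype.card G with hn
  have hn0 : n ≠ 0 := Fintype.card_ne_zero
  have hmaps : ∀ a ∈ (Finset.univ : Finset G), orderOf a ∈ n.divisors :=
    fun a _ => Nat.mem_divisors.2 ⟨orderOf_dvd_card, hn0⟩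
  rw [← Finset.sum_fiberwise_of_maps_to hmaps, Finset.mul_sum]
  calc _ = ∑ e ∈ n.divisors, (Nat.totient e : ℝ) * ((n : ℝ) / e) ^ s := by
        refine Finset.sum_congr rfl fun e he => ?_
        rw [← IsCyclic.card_orderOf_eq_totient (α := G) (Nat.dvd_of_mem_divisors he),
          ← nsmul_eq_mul, ← Finset.sum_const]
        exact Finset.sum_congr rfl fun a ha => by rw [(Finset.mem_filter.1 ha).2]
    _ = ∑ d ∈ n.divisors, (Nat.totient (n / d) : ℝ) * ((n : ℝ) / (n / d : ℕ)) ^ s :=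
        (Nat.sum_div_divisors n (fun e => (Nat.totient e : ℝ) * ((n : ℝ) / e) ^ s)).symm
    _ ≤ _ := by
        refine Finset.sum_le_sum fun d hd => ?_
        have hdn := Nat.dvd_of_mem_divisors hd
        have hd0 : (0 : ℝ) < d := by exact_mod_cast Nat.pos_of_mem_divisors hd
        have hn0' : (n : ℝ) ≠ 0 := by exact_mod_cast hn0
        have hcast : ((n / d : ℕ) : ℝ) = n / d := Nat.cast_div hdn hd0.ne'
        have h1 : (Nat.totient (n / d) : ℝ) ≤ n / d := by
          rw [← hcast]; exact_mod_cast Nat.totient_le _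
        rw [hcast, div_div_cancel₀ hn0', Real.rpow_sub_one hd0.ne']
        calc _ ≤ (n / d : ℝ) * (d : ℝ) ^ s := by gcongr
          _ = _ := by ring

/-- The order of the product group exceeds the order of a pair by a factor of at most the product of
the two indices and the greatest common divisor of the group orders. -/
theorem card_mul_card_le_orderOf_mul {G H : Type*} [Group G] [Group H] [Fintype G] [Fintype H]
    (x : G × H) :
    (Fintype.card G : ℝ) * Fintype.card H ≤
      orderOf x * (((Fintype.card G : ℝ) / orderOf x.1) * ((Fintype.card H : ℝ) / orderOf x.2) *
        Nat.gcd (Fintype.card G) (Fintype.card H)) := by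
  have h1 : 0 < orderOf x.1 := orderOf_pos _
  have h2 : 0 < orderOf x.2 := orderOf_pos _
  have hg : Nat.gcd (orderOf x.1) (orderOf x.2) ≤ Nat.gcd (Fintype.card G) (Fintype.card H) :=
    Nat.le_of_dvd (Nat.gcd_pos_of_pos_left _ Fintype.card_pos)
      (Nat.dvd_gcd ((Nat.gcd_dvd_left _ _).trans orderOf_dvd_card)
        ((Nat.gcd_dvd_right _ _).trans orderOf_dvd_card))
  have h3 : (orderOf x.1 : ℝ) * orderOf x.2 ≤
      orderOf x * Nat.gcd (Fintype.card G) (Fintype.card H) := by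
    rw [Prod.orderOf]
    have := Nat.gcd_mul_lcm (orderOf x.1) (orderOf x.2)
    have h4 : orderOf x.1 * orderOf x.2 ≤ (orderOf x.1).lcm (orderOf x.2) *
        Nat.gcd (Fintype.card G) (Fintype.card H) := by
      rw [← this, mul_comm]; exact Nat.mul_le_mul_left _ hg
    exact_mod_cast h4
  have h1' : (0 : ℝ) < orderOf x.1 := by exact_mod_cast h1
  have h2' : (0 : ℝ) < orderOf x.2 := by exact_mod_cast h2
  calc (Fintype.card G : ℝ) * Fintype.card H
      = ((Fintype.card G : ℝ) / orderOf x.1) * ((Fintype.card H : ℝ) / orderOf x.2) *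
        (orderOf x.1 * orderOf x.2) := by field_simp
    _ ≤ ((Fintype.card G : ℝ) / orderOf x.1) * ((Fintype.card H : ℝ) / orderOf x.2) *
        (orderOf x * Nat.gcd (Fintype.card G) (Fintype.card H)) := by gcongr
    _ = _ := by ring

theorem rpow_one_fifth_le_of_lt_mul {A x y z : ℝ} (hA : 0 < A) (hx : 0 ≤ x) (hy : 0 ≤ y)
    (hz : 0 ≤ z) (h : A < x * y * z) :
    A ^ (1 / 5 : ℝ) ≤ x ^ (3 / 5 : ℝ) + y ^ (3 / 5 : ℝ) + z ^ (3 / 5 : ℝ) := by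
  have hx' : 0 ≤ x ^ (3 / 5 : ℝ) := Real.rpow_nonneg hx _
  have hy' : 0 ≤ y ^ (3 / 5 : ℝ) := Real.rpow_nonneg hy _
  have hz' : 0 ≤ z ^ (3 / 5 : ℝ) := Real.rpow_nonneg hz _
  refine le_of_pow_le_pow_left₀ three_ne_zero (by positivity) ?_
  calc (A ^ (1 / 5 : ℝ)) ^ 3 = A ^ (3 / 5 : ℝ) := by
        rw [← Real.rpow_natCast, ← Real.rpow_mul hA.le]; norm_num
    _ ≤ (x * y * z) ^ (3 / 5 : ℝ) := by gcongr
    _ = x ^ (3 / 5 : ℝ) * y ^ (3 / 5 : ℝ) * z ^ (3 / 5 : ℝ) := by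
        rw [Real.mul_rpow (mul_nonneg hx hy) hz, Real.mul_rpow hx hy]
    _ ≤ (x ^ (3 / 5 : ℝ) + y ^ (3 / 5 : ℝ) + z ^ (3 / 5 : ℝ)) *
          (x ^ (3 / 5 : ℝ) + y ^ (3 / 5 : ℝ) + z ^ (3 / 5 : ℝ)) *
          (x ^ (3 / 5 : ℝ) + y ^ (3 / 5 : ℝ) + z ^ (3 / 5 : ℝ)) := by
        gcongr <;> linarith
    _ = _ := by ring

/-- Markov's inequality for the sum of the `3 / 5`-th powers of the two indices and of the greatest
common divisor of the group orders. -/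
theorem card_small_orderOf_prod_le {G H : Type*} [Group G] [Group H] [Fintype G] [Fintype H]
    [IsCyclic G] [IsCyclic H] {A : ℝ} (hA : 0 < A) :
    (Nat.card {x : G × H // (orderOf x : ℝ) < (Fintype.card G * Fintype.card H : ℝ) / A} : ℝ) *
        A ^ (1 / 5 : ℝ) ≤
      (Fintype.card G * Fintype.card H : ℝ) *
        (∑ d ∈ (Fintype.card G).divisors, (d : ℝ) ^ (-(2 / 5) : ℝ) +
          ∑ d ∈ (Fintype.card H).divisors, (d : ℝ) ^ (-(2 / 5) : ℝ) +
          ∑ d ∈ (Nat.gcd (Fintype.card G) (Fintype.card H)).divisors, (d : ℝ) ^ (3 / 5 : ℝ)) := by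
  classical
  set a := Fintype.card G
  set b := Fintype.card H
  set g := Nat.gcd a b with hg
  have hg0 : g ≠ 0 := (Nat.gcd_pos_of_pos_left _ Fintype.card_pos).ne'
  have hgsum : (g : ℝ) ^ (3 / 5 : ℝ) ≤ ∑ d ∈ g.divisors, (d : ℝ) ^ (3 / 5 : ℝ) :=
    Finset.single_le_sum (f := fun d : ℕ => (d : ℝ) ^ (3 / 5 : ℝ))
      (fun d _ => by positivity) (Nat.mem_divisors_self g hg0)
  let F : G × H → ℝ := fun x =>
    ((a : ℝ) / orderOf x.1) ^ (3 / 5 : ℝ) + ((b : ℝ) / orderOf x.2) ^ (3 / 5 : ℝ) +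
      (g : ℝ) ^ (3 / 5 : ℝ)
  have hbad : ∀ x : G × H, (orderOf x : ℝ) < (a * b : ℝ) / A → A ^ (1 / 5 : ℝ) ≤ F x := by
    intro x hx
    refine rpow_one_fifth_le_of_lt_mul hA (by positivity) (by positivity) (by positivity) ?_
    have hx0 : (0 : ℝ) < orderOf x := by exact_mod_cast orderOf_pos x
    have h1 := card_mul_card_le_orderOf_mul x
    rw [lt_div_iff₀ hA] at hx
    exact lt_of_mul_lt_mul_left (hx.trans_le h1) hx0.le
  have hsG := sum_index_rpow_le (G := G) (3 / 5)
  have hsH := sum_index_rpow_le (G := H) (3 / 5)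
  rw [show (3 / 5 - 1 : ℝ) = -(2 / 5) by norm_num] at hsG hsH
  calc _ = ∑ x : G × H with (orderOf x : ℝ) < (a * b : ℝ) / A, A ^ (1 / 5 : ℝ) := by
        rw [Finset.sum_const, nsmul_eq_mul, Nat.card_eq_fintype_card, Fintype.card_subtype]
    _ ≤ ∑ x : G × H with (orderOf x : ℝ) < (a * b : ℝ) / A, F x :=
        Finset.sum_le_sum fun x hx => hbad x (Finset.mem_filter.1 hx).2
    _ ≤ ∑ x : G × H, F x :=
        Finset.sum_le_sum_of_subset_of_nonneg (Finset.filter_subset _ _)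
          fun x _ _ => by positivity
    _ = b * ∑ x : G, ((a : ℝ) / orderOf x) ^ (3 / 5 : ℝ) +
          a * ∑ y : H, ((b : ℝ) / orderOf y) ^ (3 / 5 : ℝ) + a * b * (g : ℝ) ^ (3 / 5 : ℝ) := by
        simp only [F, Finset.sum_add_distrib, Fintype.sum_prod_type, Finset.sum_const,
          Finset.card_univ, nsmul_eq_mul, Fintype.card_prod, Nat.cast_mul, ← Finset.mul_sum]
        ring
    _ ≤ b * (a * ∑ d ∈ a.divisors, (d : ℝ) ^ (-(2 / 5) : ℝ)) +
          a * (b * ∑ d ∈ b.divisors, (d : ℝ) ^ (-(2 / 5) : ℝ)) +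
          a * b * ∑ d ∈ g.divisors, (d : ℝ) ^ (3 / 5 : ℝ) := by
        gcongr
    _ = _ := by ring

theorem probPeriodLT_mul_le {p q : ℕ} (hp : p.Prime) (hq : q.Prime) (hpq : p ≠ q) {A : ℝ}
    (hA : 0 < A) :
    probPeriodLT (p * q) ((Nat.totient (p * q) : ℝ) / A) ≤ A ^ (-(1 / 5) : ℝ) *
      (∑ d ∈ (p - 1).divisors, (d : ℝ) ^ (-(2 / 5) : ℝ) +
        ∑ d ∈ (q - 1).divisors, (d : ℝ) ^ (-(2 / 5) : ℝ) +
        ∑ d ∈ (Nat.gcd (p - 1) (q - 1)).divisors, (d : ℝ) ^ (3 / 5 : ℝ)) := by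
  have : Fact p.Prime := ⟨hp⟩
  have : Fact q.Prime := ⟨hq⟩
  have hcop : Nat.Coprime p q := (Nat.coprime_primes hp hq).2 hpq
  let e : (ZMod (p * q))ˣ ≃* (ZMod p)ˣ × (ZMod q)ˣ :=
    (Units.mapEquiv (ZMod.chineseRemainder hcop).toMulEquiv).trans MulEquiv.prodUnits
  have hcp : Fintype.card (ZMod p)ˣ = p - 1 := ZMod.card_units p
  have hcq : Fintype.card (ZMod q)ˣ = q - 1 := ZMod.card_units q
  have htot : (Nat.totient (p * q) : ℝ) =
      Fintype.card (ZMod p)ˣ * Fintype.card (ZMod q)ˣ := by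
    rw [Nat.totient_mul hcop, Nat.totient_prime hp, Nat.totient_prime hq, hcp, hcq]
    push_cast; rfl
  have hcard : (Nat.card (ZMod (p * q))ˣ : ℝ) =
      Fintype.card (ZMod p)ˣ * Fintype.card (ZMod q)ˣ := by
    rw [Nat.card_congr e.toEquiv, Nat.card_prod, Nat.card_eq_fintype_card,
      Nat.card_eq_fintype_card]
    push_cast; rfl
  have hbad : Nat.card {u : (ZMod (p * q))ˣ // (orderOf u : ℝ) < (Nat.totient (p * q) : ℝ) / A} =
      Nat.card {x : (ZMod p)ˣ × (ZMod q)ˣ //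
        (orderOf x : ℝ) < (Fintype.card (ZMod p)ˣ * Fintype.card (ZMod q)ˣ : ℝ) / A} := by
    refine Nat.card_congr (e.toEquiv.subtypeEquiv fun u => ?_)
    rw [htot, show e.toEquiv u = e u from rfl, e.orderOf_eq]
  have hmain := card_small_orderOf_prod_le (G := (ZMod p)ˣ) (H := (ZMod q)ˣ) hA
  have hpos : (0 : ℝ) < Fintype.card (ZMod p)ˣ * Fintype.card (ZMod q)ˣ := by
    exact_mod_cast Nat.mul_pos Fintype.card_pos Fintype.card_pos
  rw [probPeriodLT, hbad, hcard, div_le_iff₀ hpos, Real.rpow_neg hA.le]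
  rw [← le_div_iff₀ (by positivity)] at hmain
  refine hmain.trans (le_of_eq ?_)
  rw [hcp, hcq, div_eq_mul_inv]
  ring

/-! ### Averages over the primes of length `m` -/

theorem sum_sum_divisors_eq {ι : Type*} (T : Finset ι) (h : ι → ℕ) (L : ℕ)
    (hT : ∀ x ∈ T, 0 < h x ∧ h x ≤ L) (f : ℕ → ℝ) :
    ∑ x ∈ T, ∑ d ∈ (h x).divisors, f d =
      ∑ d ∈ Finset.Icc 1 L, f d * (T.filter (fun x => d ∣ h x)).card := by
  have h1 : ∀ x ∈ T, ∑ d ∈ (h x).divisors, f d =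
      ∑ d ∈ Finset.Icc 1 L, if d ∣ h x then f d else 0 := by
    intro x hx
    obtain ⟨h0, hL⟩ := hT x hx
    rw [← Finset.sum_filter]
    refine Finset.sum_congr ?_ fun _ _ => rfl
    ext d
    simp only [Nat.mem_divisors, Finset.mem_filter, Finset.mem_Icc]
    constructor
    · rintro ⟨h2, -⟩
      exact ⟨⟨Nat.pos_of_dvd_of_pos h2 h0, (Nat.le_of_dvd h0 h2).trans hL⟩, h2⟩
    · rintro ⟨-, h2⟩
      exact ⟨h2, h0.ne'⟩
  rw [Finset.sum_congr rfl h1, Finset.sum_comm]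
  refine Finset.sum_congr rfl fun d _ => ?_
  rw [← Finset.sum_filter, Finset.sum_const, nsmul_eq_mul, mul_comm]

theorem sub_one_pos_and_le_of_mem_primesOfLength {m p : ℕ} (hp : p ∈ primesOfLength m) :
    0 < p - 1 ∧ p - 1 ≤ 2 ^ m := by
  obtain ⟨⟨-, h1⟩, h2⟩ := mem_primesOfLength.1 hp
  have := h2.two_le
  omega

/-- The `d`-th summand is `O(d ^ (-2 / 5 - 9 / 10))` after exchanging the sums, hence summable. -/
theorem exists_sum_sum_divisors_sub_one_le :
    ∃ C : ℝ, 0 < C ∧ ∀ m : ℕ, 2 ≤ m →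
      ∑ p ∈ primesOfLength m, ∑ d ∈ (p - 1).divisors, (d : ℝ) ^ (-(2 / 5) : ℝ) ≤
        C * (primesOfLength m).card := by
  obtain ⟨C, hC, h⟩ := exists_card_primes_dvd_sub_one_le
  have hsum : Summable fun d : ℕ => (d : ℝ) ^ (-(13 / 10) : ℝ) :=
    Real.summable_nat_rpow.2 (by norm_num)
  have hnn : (0 : ℝ) ≤ ∑' d : ℕ, (d : ℝ) ^ (-(13 / 10) : ℝ) :=
    tsum_nonneg fun d => by positivity
  refine ⟨C * (∑' d : ℕ, (d : ℝ) ^ (-(13 / 10) : ℝ) + 1), by positivity, fun m hm => ?_⟩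
  rw [sum_sum_divisors_eq (primesOfLength m) (fun p => p - 1) (2 ^ m)
    (fun p hp => sub_one_pos_and_le_of_mem_primesOfLength hp)]
  calc _ ≤ ∑ d ∈ Finset.Icc (1 : ℕ) (2 ^ m),
        C * (primesOfLength m).card * (d : ℝ) ^ (-(13 / 10) : ℝ) := by
        refine Finset.sum_le_sum fun d hd => ?_
        have hd1 := (Finset.mem_Icc.1 hd).1
        have hd0 : (0 : ℝ) < d := by exact_mod_cast hd1
        rw [show (-(13 / 10) : ℝ) = -(2 / 5) + -(9 / 10) by norm_num, Real.rpow_add hd0]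
        calc _ ≤ (d : ℝ) ^ (-(2 / 5) : ℝ) *
              (C * (primesOfLength m).card * (d : ℝ) ^ (-(9 / 10) : ℝ)) := by
              gcongr
              exact h m d hm hd1
          _ = _ := by ring
    _ ≤ C * (primesOfLength m).card * (∑' d : ℕ, (d : ℝ) ^ (-(13 / 10) : ℝ) + 1) := by
        rw [← Finset.mul_sum]
        gcongr
        exact (hsum.sum_le_tsum _ fun d _ => by positivity).trans (by linarith)
    _ = _ := by ring

theorem card_pairs_dvd_gcd_sub_one (m d : ℕ) :
    ((primesOfLength m ×ˢ primesOfLength m).filter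
        (fun x => d ∣ Nat.gcd (x.1 - 1) (x.2 - 1))).card =
      ((primesOfLength m).filter (fun p => d ∣ p - 1)).card ^ 2 := by
  rw [sq, ← Finset.card_product, ← Finset.filter_product]
  simp only [Nat.dvd_gcd_iff]

/-- The `d`-th summand is `O(d ^ (3 / 5 - 2 * (9 / 10)))` after exchanging the sums, because `p` and
`q` range independently; hence it is summable. -/
theorem exists_sum_sum_divisors_gcd_le :
    ∃ C : ℝ, 0 < C ∧ ∀ m : ℕ, 2 ≤ m →
      ∑ x ∈ primesOfLength m ×ˢ primesOfLength m,
        ∑ d ∈ (Nat.gcd (x.1 - 1) (x.2 - 1)).divisors, (d : ℝ) ^ (3 / 5 : ℝ) ≤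
        C * ((primesOfLength m).card : ℝ) ^ 2 := by
  obtain ⟨C, hC, h⟩ := exists_card_primes_dvd_sub_one_le
  have hsum : Summable fun d : ℕ => (d : ℝ) ^ (-(6 / 5) : ℝ) :=
    Real.summable_nat_rpow.2 (by norm_num)
  have hnn : (0 : ℝ) ≤ ∑' d : ℕ, (d : ℝ) ^ (-(6 / 5) : ℝ) :=
    tsum_nonneg fun d => by positivity
  refine ⟨C ^ 2 * (∑' d : ℕ, (d : ℝ) ^ (-(6 / 5) : ℝ) + 1), by positivity, fun m hm => ?_⟩
  rw [sum_sum_divisors_eq (primesOfLength m ×ˢ primesOfLength m)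
    (fun x => Nat.gcd (x.1 - 1) (x.2 - 1)) (2 ^ m) fun x hx => by
      obtain ⟨h1, h2⟩ := Finset.mem_product.1 hx
      obtain ⟨h3, h4⟩ := sub_one_pos_and_le_of_mem_primesOfLength h1
      exact ⟨Nat.gcd_pos_of_pos_left _ h3, (Nat.gcd_le_left _ h3).trans h4⟩]
  calc _ ≤ ∑ d ∈ Finset.Icc (1 : ℕ) (2 ^ m),
        (C * (primesOfLength m).card) ^ 2 * (d : ℝ) ^ (-(6 / 5) : ℝ) := by
        refine Finset.sum_le_sum fun d hd => ?_
        have hd1 := (Finset.mem_Icc.1 hd).1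
        have hd0 : (0 : ℝ) < d := by exact_mod_cast hd1
        rw [card_pairs_dvd_gcd_sub_one, Nat.cast_pow,
          show (-(6 / 5) : ℝ) = 3 / 5 + (-(9 / 10) + -(9 / 10)) by norm_num,
          Real.rpow_add hd0, Real.rpow_add hd0]
        calc _ ≤ (d : ℝ) ^ (3 / 5 : ℝ) *
              (C * (primesOfLength m).card * (d : ℝ) ^ (-(9 / 10) : ℝ)) ^ 2 := by
              gcongr
              exact h m d hm hd1
          _ = _ := by ring
    _ ≤ (C * (primesOfLength m).card) ^ 2 * (∑' d : ℕ, (d : ℝ) ^ (-(6 / 5) : ℝ) + 1) := by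
        rw [← Finset.mul_sum]
        gcongr
        exact (hsum.sum_le_tsum _ fun d _ => by positivity).trans (by linarith)
    _ = _ := by ring

theorem sq_card_primesOfLength_le_two_mul_card_distinctPrimePairs {m : ℕ}
    (h : 0 < (distinctPrimePairs m).card) :
    ((primesOfLength m).card : ℝ) ^ 2 ≤ 2 * (distinctPrimePairs m).card := by
  have h1 : (distinctPrimePairs m).card =
      (primesOfLength m).card * (primesOfLength m).card - (primesOfLength m).card :=
    Finset.offDiag_card _
  have h2 : 2 ≤ (primesOfLength m).card := by
    by_contra hlt
    have : (primesOfLength m).card = 0 ∨ (primesOfLength m).card = 1 := by omega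
    rcases this with h3 | h3 <;> rw [h3] at h1 <;> omega
  rw [h1, Nat.cast_sub (Nat.le_mul_self _), Nat.cast_mul]
  have h3 : (2 : ℝ) ≤ (primesOfLength m).card := by exact_mod_cast h2
  nlinarith

/-- A period below `φ(N) / A` has probability `O(A ^ (-1 / 5))`, uniformly in the length `m`. -/
theorem exists_probSmallPeriod_le :
    ∃ C : ℝ, 0 < C ∧ ∀ m : ℕ, 2 ≤ m → ∀ A : ℝ, 0 < A →
      probSmallPeriod m A ≤ C * A ^ (-(1 / 5) : ℝ) := by
  obtain ⟨C₁, hC₁, h₁⟩ := exists_sum_sum_divisors_sub_one_le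
  obtain ⟨C₂, hC₂, h₂⟩ := exists_sum_sum_divisors_gcd_le
  refine ⟨2 * (C₁ + C₁ + C₂), by positivity, fun m hm A hA => ?_⟩
  rw [probSmallPeriod]
  rcases (distinctPrimePairs m).card.eq_zero_or_pos with h0 | h0
  -- Without pairs the average is a division by zero, with value zero.
  · rw [h0, Nat.cast_zero, div_zero]
    positivity
  have hpos : (0 : ℝ) < (distinctPrimePairs m).card := by exact_mod_cast h0
  set S := primesOfLength m with hS
  let F : ℕ → ℝ := fun p => ∑ d ∈ (p - 1).divisors, (d : ℝ) ^ (-(2 / 5) : ℝ)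
  let E : ℕ × ℕ → ℝ := fun x =>
    ∑ d ∈ (Nat.gcd (x.1 - 1) (x.2 - 1)).divisors, (d : ℝ) ^ (3 / 5 : ℝ)
  rw [div_le_iff₀ hpos]
  calc _ ≤ ∑ x ∈ distinctPrimePairs m, A ^ (-(1 / 5) : ℝ) * (F x.1 + F x.2 + E x) := by
        refine Finset.sum_le_sum fun x hx => ?_
        obtain ⟨h1, h2, h3⟩ := Finset.mem_offDiag.1 hx
        exact probPeriodLT_mul_le (mem_primesOfLength.1 h1).2 (mem_primesOfLength.1 h2).2 h3 hA
    -- Adding the diagonal back makes the two primes independent.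
    _ ≤ ∑ x ∈ S ×ˢ S, A ^ (-(1 / 5) : ℝ) * (F x.1 + F x.2 + E x) := by
        refine Finset.sum_le_sum_of_subset_of_nonneg (fun x hx => ?_) fun x _ _ => by positivity
        obtain ⟨h1, h2, -⟩ := Finset.mem_offDiag.1 hx
        exact Finset.mem_product.2 ⟨h1, h2⟩
    _ = A ^ (-(1 / 5) : ℝ) *
          (S.card * ∑ p ∈ S, F p + S.card * ∑ p ∈ S, F p + ∑ x ∈ S ×ˢ S, E x) := by
        rw [← Finset.mul_sum, Finset.sum_add_distrib, Finset.sum_add_distrib,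
          Finset.sum_product, Finset.sum_product]
        simp only [Finset.sum_const, nsmul_eq_mul, ← Finset.mul_sum]
    _ ≤ A ^ (-(1 / 5) : ℝ) *
          (S.card * (C₁ * S.card) + S.card * (C₁ * S.card) + C₂ * (S.card : ℝ) ^ 2) := by
        gcongr
        · exact h₁ m hm
        · exact h₁ m hm
        · exact h₂ m hm
    _ = (C₁ + C₁ + C₂) * A ^ (-(1 / 5) : ℝ) * (S.card : ℝ) ^ 2 := by ring
    _ ≤ (C₁ + C₁ + C₂) * A ^ (-(1 / 5) : ℝ) * (2 * (distinctPrimePairs m).card) := by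
        gcongr
        exact sq_card_primesOfLength_le_two_mul_card_distinctPrimePairs h0
    _ = _ := by ring

theorem mainTheorem5 (k : ℝ) (hk : 2 ≤ k) :
    ∃ C : ℝ, 0 < C ∧ ∀ m : ℕ, 2 ≤ m →
      probSmallPeriod m ((m : ℝ) ^ k) ≤
        C * (1 / ((m : ℝ) ^ ((k - 2) / 5) * (Real.log (m : ℝ)) ^ ((2 : ℝ) / 5))) := by
  obtain ⟨C, hC, h⟩ := exists_probSmallPeriod_le
  refine ⟨C, hC, fun m hm => ?_⟩
  have hm0 : (0 : ℝ) < m := by exact_mod_cast (by omega : 0 < m)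
  have hlog : 0 < Real.log m := Real.log_pos (by exact_mod_cast (by omega : 1 < m))
  refine (h m hm _ (Real.rpow_pos_of_pos hm0 k)).trans ?_
  gcongr
  rw [← Real.rpow_mul hm0.le, show k * -(1 / 5) = -(k / 5) by ring, Real.rpow_neg hm0.le,
    ← one_div]
  gcongr
  calc _ ≤ (m : ℝ) ^ ((k - 2) / 5) * (m : ℝ) ^ ((2 : ℝ) / 5) := by
        gcongr
        exact Real.log_le_self hm0.le
    _ = (m : ℝ) ^ (k / 5) := by rw [← Real.rpow_add hm0]; ring_nf
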